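/- Let $d\ge 1$ be an integer. Consider the impartial game played on a total $n\ge 1$ in which a move replaces the total $n\ge 2$ by $n-1$ or by $\lceil n/(2d)\rceil$; there is no move from $1$. Its Sprague–Grundy function is given by $SG_{1,2d}(1)=0$ and $SG_{1,2d}(n)=\operatorname{mex}\{SG_{1,2d}(n-1),\,SG_{1,2d}(\lceil n/(2d)\rceil)\}$ for $n\ge 2$, where $\operatorname{mex}T$ is the least non-negative integer not in $T$. An integer sequence $(s(n))_{n\ge 0}$ is called $k$-regular if it is completely defined by finitely many recurrences of the form $$s(k^m n+r)=\sum_{i=1}^{L}c_i\,s(k^{m_i}n+r_i)\qquad(n\ge 0),$$ with $m_i<m$, $0\le r<k^m$, $0\le r_i<k^{m_i}$ and integer constants $c_i$; that is, there are finitely many such recurrences whose residue classes $r \bmod k^m$ cover all natural numbers (here $m,r,L,c_i,m_i,r_i$ depend on the recurrence). Theorem. The sequence $(SG_{1,2d}(n))_{n\ge 1}$, extended by an arbitrary integer value at $n=0$, is $2d$-regular. Moreover, the recurrences can be chosen to be reductions: there are finitely many residue classes $r\bmod (2d)^m$, covering all natural numbers, for each of which there are $m'<m$ and $0\le r'<(2d)^{m'}$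 such that $$s((2d)^m n+r)=s((2d)^{m'}n+r')\qquad\text{for all } n\ge 0,$$ where $s$ denotes the extended sequence. (For $n\ge1$ the index on the right is smaller than the index on the left.) -/

import Mathlib

/-- The minimum excluded value of a set of natural numbers. -/
noncomputable def mex (T : Set ℕ) : ℕ := sInf {x | x ∉ T}

/-- The totals reachable in one move from the total `n` in the game `G_{a,b}`: subtract `a`, or
divide by `b` and round up. Totals are at least `1`, and a move has to reduce the total (so there
is no move from `1`, although `⌈1/b⌉ = 1`). -/
def moves (a b n : ℕ) : Set ℕ :=
  {m | 1 ≤ m ∧ m < n ∧ (m + a = n ∨ m = n ⌈/⌉ b)}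

/-- The Sprague–Grundy value `SG_{a,b}(n)`: the mex of the values of the totals reachable from
`n` in one move. -/
noncomputable def SG (a b : ℕ) (n : ℕ) : ℕ :=
  mex {v | ∃ m, ∃ _ : m ∈ moves a b n, v = SG a b m}
termination_by n
decreasing_by
  rename_i h
  exact h.2.1

/-- A finite set `C` of pairs `(m, r)` with `r < k ^ m` whose residue classes
`r mod k ^ m` together contain every natural number. -/
def CoversByClasses (k : ℕ) (C : Finset (ℕ × ℕ)) : Prop :=
  (∀ p ∈ C, p.2 < k ^ p.1) ∧ ∀ N : ℕ, ∃ p ∈ C, ∃ n : ℕ, N = k ^ p.1 * n + p.2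

/-- `k`-regular integer sequences: the sequence is completely defined by finitely many recurrences
`s (k ^ m * n + r) = ∑ i, c i * s (k ^ (e i) * n + t i)` (`n = 0, 1, 2, …`) with `e i < m`,
`0 ≤ r < k ^ m`, `0 ≤ t i < k ^ (e i)` and constants `c i`, one for each class `r mod k ^ m` of a
finite covering of the natural numbers. (For `k ≥ 2` and `n ≥ 1` the indices on the right are
smaller than the one on the left, so the recurrences and finitely many initial values
determine `s`.) -/
def IsRegularSeq (k : ℕ) (s : ℕ → ℤ) : Prop :=
  ∃ C : Finset (ℕ × ℕ), CoversByClasses k C ∧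
    ∀ p ∈ C, ∃ (L : ℕ) (c : Fin L → ℤ) (e t : Fin L → ℕ),
      (∀ i, e i < p.1 ∧ t i < k ^ e i) ∧
      ∀ n : ℕ, s (k ^ p.1 * n + p.2) = ∑ i, c i * s (k ^ e i * n + t i)

/-- The sequence has a complete finite set of reductions: each class `r mod k ^ m` of some finite
covering of the natural numbers is identified, term by term, with a residue class modulo a smaller
power of `k`. -/
def HasCompleteReductions (k : ℕ) (s : ℕ → ℤ) : Prop :=
  ∃ C : Finset (ℕ × ℕ), CoversByClasses k C ∧
    ∀ p ∈ C, ∃ e t : ℕ, e < p.1 ∧ t < k ^ e ∧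
      ∀ n : ℕ, s (k ^ p.1 * n + p.2) = s (k ^ e * n + t)

/-! Write k = 2d. On the block of totals with ⌈n/k⌉ = p + 1, each value is the mex of its
predecessor and the fixed value `g (p + 1)`. A zero of `g` erases memory: the block it governs ends
in a nonzero value, so the next block alternates between 0 and one nonzero value, and as k is even
its last value depends on its governing value alone (`eq_of_zero`). Zeros occur with bounded gaps
(`exists_zero`), so a bounded window of `g` near q determines the window near kq + r
(`window_step`), hence, iterating, near k^m q + r. The k-kernel is therefore finite, and finiteness
forces every class of some high level to repeat one of lower level. -/

theorem mex_pair_eq {a b c : ℕ} (hca : c ≠ a) (hcb : c ≠ b)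
    (h : ∀ x < c, x = a ∨ x = b) : mex {a, b} = c := by
  apply le_antisymm
  · exact Nat.sInf_le (by simp [hca, hcb])
  · refine le_csInf ⟨c, by simp [hca, hcb]⟩ fun x hx => ?_
    by_contra hlt
    exact hx (by simpa using h x (by omega))

theorem mex_pair_spec (a b : ℕ) : mex {a, b} ≠ a ∧ mex {a, b} ≠ b ∧ mex {a, b} ≤ 2 := by
  have key : ∃ c, c ≠ a ∧ c ≠ b ∧ c ≤ 2 ∧ ∀ x < c, x = a ∨ x = b := by
    by_cases h0 : 0 = a ∨ 0 = b
    · by_cases h1 : 1 = a ∨ 1 = b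
      · exact ⟨2, by omega, by omega, le_rfl, by omega⟩
      · exact ⟨1, by omega, by omega, by omega, by omega⟩
    · exact ⟨0, by omega, by omega, by omega, by omega⟩
  obtain ⟨c, hca, hcb, hc, h⟩ := key
  rw [mex_pair_eq hca hcb h]
  exact ⟨hca, hcb, hc⟩

theorem SG_one_eq {k n : ℕ} (hk : 2 ≤ k) (hn : 2 ≤ n) :
    SG 1 k n = mex {SG 1 k (n - 1), SG 1 k (n ⌈/⌉ k)} := by
  have hpos : 1 ≤ n ⌈/⌉ k := by
    rw [Nat.ceilDiv_eq_add_pred_div]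
    exact (Nat.one_le_div_iff (by omega)).2 (by omega)
  have hlt : n ⌈/⌉ k < n := by
    rw [Nat.ceilDiv_eq_add_pred_div, Nat.div_lt_iff_lt_mul (by omega)]
    have : 2 * n ≤ n * k := by rw [mul_comm n k]; exact Nat.mul_le_mul_right n hk
    have : 2 * k ≤ n * k := Nat.mul_le_mul_right k hn
    omega
  rw [SG]
  congr 1
  ext v
  simp only [moves, Set.mem_ofPred_eq, Set.mem_insert_iff, Set.mem_singleton_iff, exists_prop]
  constructor
  · rintro ⟨m, ⟨-, -, h | h⟩, rfl⟩
    · left; rw [← h, Nat.add_sub_cancel]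
    · right; rw [h]
  · rintro (rfl | rfl)
    · exact ⟨n - 1, ⟨by omega, by omega, Or.inl (by omega)⟩, rfl⟩
    · exact ⟨_, ⟨hpos, hlt, Or.inr rfl⟩, rfl⟩

/-! ### Block structure and the resetting effect of zeros -/

/-- The recurrence satisfied by `SG 1 k` on the block of totals `n` with `⌈n/k⌉ = p + 1`. -/
def BlockRec (k : ℕ) (g : ℕ → ℕ) : Prop :=
  ∀ p j : ℕ, j < k → 1 ≤ k * p + j → g (k * p + j + 1) = mex {g (k * p + j), g (p + 1)}

theorem blockRec_SG {k : ℕ} (hk : 2 ≤ k) : BlockRec k (SG 1 k) := by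
  intro p j hj h1
  rw [SG_one_eq hk (by omega), Nat.add_sub_cancel]
  congr
  rw [Nat.ceilDiv_eq_add_pred_div]
  apply Nat.div_eq_of_lt_le
  · rw [add_mul, mul_comm p k]; omega
  · rw [add_mul, add_mul, mul_comm p k]; omega

namespace BlockRec

variable {k : ℕ} {g : ℕ → ℕ}

theorem exists_block (hk : 2 ≤ k) {n : ℕ} (hn : 1 ≤ n) :
    ∃ p j, j < k ∧ n = k * p + j + 1 := by
  refine ⟨(n - 1) / k, (n - 1) % k, Nat.mod_lt _ (by omega), ?_⟩
  rw [Nat.div_add_mod]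
  omega

theorem spec (hg : BlockRec k g) (hk : 2 ≤ k) {n : ℕ} (hn : 2 ≤ n) :
    g n ≠ g (n - 1) ∧ g n ≤ 2 := by
  obtain ⟨p, j, hj, rfl⟩ := exists_block hk (show 1 ≤ n by omega)
  rw [hg p j hj (by omega), Nat.add_sub_cancel]
  exact ⟨(mex_pair_spec _ _).1, (mex_pair_spec _ _).2.2⟩

/-- A zero at `q - 1` makes the value at `k * q` a function of the value at `q` alone. -/
theorem eq_of_zero (hg : BlockRec k g) (hk : 2 ≤ k) (hev : Even k) {q : ℕ} (hq : 1 ≤ q)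
    (h0 : g (q + 1) = 0) : g (k * (q + 2)) = 3 - g (q + 2) := by
  have hkq : 1 ≤ k * q := Nat.mul_pos (by omega) hq
  have hb : g (q + 2) ≠ 0 ∧ g (q + 2) ≤ 2 := by
    have := hg.spec hk (show 2 ≤ q + 2 by omega)
    rw [show q + 2 - 1 = q + 1 by omega, h0] at this
    exact this
  have hstart : g (k * (q + 1)) ≠ 0 := by
    have e : k * (q + 1) = k * q + (k - 1) + 1 := by rw [mul_add]; omega
    rw [e, hg q (k - 1) (by omega) (by omega), h0]
    exact (mex_pair_spec _ _).2.1
  have hmex : mex {0, g (q + 2)} = 3 - g (q + 2) :=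
    mex_pair_eq (by omega) (by omega) (by omega)
  -- A nonzero predecessor gives 0, then `mex {0, g (q + 2)}`, nonzero again; evenness of `k` makes
  -- the block end on the latter.
  have step : ∀ i, 2 * i + 2 ≤ k → g (k * (q + 1) + 2 * i) ≠ 0 →
      g (k * (q + 1) + (2 * i + 2)) = 3 - g (q + 2) := by
    intro i hi hne
    have h1 := hg (q + 1) (2 * i) (by omega) (by rw [mul_add]; omega)
    have h2 := hg (q + 1) (2 * i + 1) (by omega) (by omega)
    rw [mex_pair_eq (c := 0) hne.symm hb.1.symm (by simp)] at h1
    rw [← add_assoc, h1, hmex] at h2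
    exact h2
  have all : ∀ i, 2 * i + 2 ≤ k → g (k * (q + 1) + (2 * i + 2)) = 3 - g (q + 2) := by
    intro i
    induction i with
    | zero => intro hi; exact step 0 hi (by simpa using hstart)
    | succ i ih =>
      intro hi
      refine step (i + 1) hi ?_
      rw [show 2 * (i + 1) = 2 * i + 2 by ring, ih (by omega)]
      omega
  obtain ⟨d, rfl⟩ := hev
  have := all (d - 1) (by omega)
  rwa [show (d + d) * (q + 1) + (2 * (d - 1) + 2) = (d + d) * (q + 2) by
    rw [show 2 * (d - 1) + 2 = d + d by omega]; ring] at this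

/-- A block governed by a nonzero value has a zero among its first two entries, and two consecutive
governing values are never both zero. -/
theorem exists_zero (hg : BlockRec k g) (hk : 2 ≤ k) {n : ℕ} (hn : 1 ≤ n) :
    ∃ i ≤ 3 * k, g (n + i) = 0 := by
  have block : ∀ p, n ≤ k * p → k * p < n + 2 * k → g (p + 1) ≠ 0 →
      ∃ i ≤ 3 * k, g (n + i) = 0 := by
    intro p hp hp' hb
    by_cases h1 : g (k * p + 1) = 0
    · exact ⟨k * p + 1 - n, by omega, by rwa [Nat.add_sub_cancel' (by omega)]⟩
    · refine ⟨k * p + 2 - n, by omega, ?_⟩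
      rw [Nat.add_sub_cancel' (by omega), show k * p + 2 = k * p + 1 + 1 by ring,
        hg p 1 (by omega) (by omega)]
      exact mex_pair_eq (Ne.symm h1) hb.symm (by simp)
  obtain ⟨p, j, hj, e⟩ := exists_block hk hn
  have e1 : k * (p + 1) = k * p + k := by ring
  have e2 : k * (p + 2) = k * p + 2 * k := by ring
  by_cases hb : g (p + 2) = 0
  · refine block (p + 2) (by omega) (by omega) ?_
    have := (hg.spec hk (show 2 ≤ p + 2 + 1 by omega)).1
    rwa [Nat.add_sub_cancel, hb] at this
  · exact block (p + 1) (by omega) (by omega) hb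

theorem eq_in_block (hg : BlockRec k g) {p p' : ℕ} (hk : 2 ≤ k) (hp : 1 ≤ p) (hp' : 1 ≤ p')
    (h : g (k * p) = g (k * p')) (hb : g (p + 1) = g (p' + 1)) :
    ∀ j ≤ k, g (k * p + j) = g (k * p' + j) := by
  have h1 : 1 ≤ k * p := Nat.mul_pos (by omega) hp
  have h1' : 1 ≤ k * p' := Nat.mul_pos (by omega) hp'
  intro j
  induction j with
  | zero => intro _; exact h
  | succ j ih =>
    intro hj
    rw [← add_assoc, ← add_assoc, hg p j hj (by omega), hg p' j hj (by omega), ih (by omega), hb]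

/-- Equal stretches of length `3k + 2` force equal values at the `k`-fold ends. -/
theorem eq_of_history (hg : BlockRec k g) (hk : 2 ≤ k) (hev : Even k) {q q' : ℕ}
    (hq : 2 ≤ q) (hq' : 2 ≤ q')
    (h : ∀ i ≤ 3 * k + 1, g (q + i) = g (q' + i)) :
    g (k * (q + (3 * k + 1))) = g (k * (q' + (3 * k + 1))) := by
  obtain ⟨i, hi, h0⟩ := hg.exists_zero hk (show 1 ≤ q by omega)
  have h0' : g (q' + i) = 0 := by rw [← h i (by omega), h0]
  -- The zero resets both sides; `run` then carries the agreement on block by block.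
  have base : g (k * (q + (i + 1))) = g (k * (q' + (i + 1))) := by
    have a := hg.eq_of_zero hk hev (q := q + i - 1) (by omega)
      (by rwa [Nat.sub_add_cancel (by omega)])
    have a' := hg.eq_of_zero hk hev (q := q' + i - 1) (by omega)
      (by rwa [Nat.sub_add_cancel (by omega)])
    rw [show q + i - 1 + 2 = q + (i + 1) by omega] at a
    rw [show q' + i - 1 + 2 = q' + (i + 1) by omega] at a'
    rw [a, a', h (i + 1) (by omega)]
  have run : ∀ t, i + 1 + t ≤ 3 * k + 1 →
      g (k * (q + (i + 1 + t))) = g (k * (q' + (i + 1 + t))) := by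
    intro t
    induction t with
    | zero => intro _; exact base
    | succ t ih =>
      intro ht
      have := hg.eq_in_block hk (by omega) (by omega) (ih (by omega))
        (h (i + 1 + t + 1) (by omega)) k le_rfl
      rwa [← mul_add_one, ← mul_add_one] at this
  have := run (3 * k - i) (by omega)
  rwa [show i + 1 + (3 * k - i) = 3 * k + 1 by omega] at this

end BlockRec

/-! ### Windows and their propagation -/

/-- The stretch of `g` of length `w + 1` that ends at `q + 1`. -/
def window (g : ℕ → ℕ) (w q : ℕ) : Fin (w + 1) → ℕ := fun i => g (q + 1 - i)

theorem window_eq_iff {g : ℕ → ℕ} {w q q' : ℕ} :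
    window g w q = window g w q' ↔ ∀ i ≤ w, g (q + 1 - i) = g (q' + 1 - i) := by
  constructor
  · intro h i hi
    exact congrFun h ⟨i, by omega⟩
  · intro h
    funext i
    exact h i (by omega)

/-- A long enough window at `q` determines the windows at the totals `k * q + r`. -/
theorem BlockRec.window_step {k : ℕ} {g : ℕ → ℕ} (hg : BlockRec k g) (hk : 2 ≤ k)
    (hev : Even k) {q q' r : ℕ} (hr : r < k) (hq : 6 * k + 10 ≤ q) (hq' : 6 * k + 10 ≤ q')
    (h : window g (6 * k + 8) q = window g (6 * k + 8) q') :
    window g (6 * k + 8) (k * q + r) = window g (6 * k + 8) (k * q' + r) := by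
  rw [window_eq_iff] at h ⊢
  intro i hi
  have hle : 6 * k + 10 ≤ k * q := hq.trans (Nat.le_mul_of_pos_left _ (by omega))
  have hle' : 6 * k + 10 ≤ k * q' := hq'.trans (Nat.le_mul_of_pos_left _ (by omega))
  obtain ⟨p, j, hj, e⟩ := exists_block hk (show 1 ≤ k * q + r + 1 - i by omega)
  have hpq : p ≤ q := by
    by_contra hlt
    have : k * (q + 1) ≤ k * p := Nat.mul_le_mul_left k (by omega)
    rw [mul_add] at this
    omega
  obtain ⟨t, rfl⟩ := Nat.exists_eq_add_of_le hpq
  -- Going back `6k + 8` near `k * q` moves only boundedly many blocks, which leaves `3k + 2` window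
  -- entries before `p + 1` for the history.
  have ht : t ≤ 3 * k + 5 := by
    by_contra hlt
    have : k * 12 ≤ k * t := Nat.mul_le_mul_left k (by omega)
    rw [mul_add] at e
    omega
  obtain ⟨p', rfl⟩ : ∃ p', q' = p' + t := ⟨q' - t, by omega⟩
  have e' : k * (p' + t) + r + 1 - i = k * p' + (j + 1) := by
    rw [mul_add] at e hle hle' ⊢
    omega
  rw [e, e', add_assoc]
  have hist : ∀ a ≤ 3 * k + 2, g (p - (3 * k + 1) + a) = g (p' - (3 * k + 1) + a) := by
    intro a ha
    have := h (t + (3 * k + 2) - a) (by omega)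
    rwa [show p + t + 1 - (t + (3 * k + 2) - a) = p - (3 * k + 1) + a by omega,
      show p' + t + 1 - (t + (3 * k + 2) - a) = p' - (3 * k + 1) + a by omega] at this
  have hend := hg.eq_of_history hk hev (q := p - (3 * k + 1)) (q' := p' - (3 * k + 1))
    (by omega) (by omega) fun a ha => hist a (by omega)
  rw [Nat.sub_add_cancel (by omega), Nat.sub_add_cancel (by omega)] at hend
  have hnext := hist (3 * k + 2) le_rfl
  rw [show p - (3 * k + 1) + (3 * k + 2) = p + 1 by omega,
    show p' - (3 * k + 1) + (3 * k + 2) = p' + 1 by omega] at hnext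
  exact hg.eq_in_block hk (by omega) (by omega) hend hnext (j + 1) hj

theorem BlockRec.window_pow {k : ℕ} {g : ℕ → ℕ} (hg : BlockRec k g) (hk : 2 ≤ k)
    (hev : Even k) (m : ℕ) : ∀ {q q' r : ℕ}, r < k ^ m → 6 * k + 10 ≤ q → 6 * k + 10 ≤ q' →
    window g (6 * k + 8) q = window g (6 * k + 8) q' →
    window g (6 * k + 8) (k ^ m * q + r) = window g (6 * k + 8) (k ^ m * q' + r) := by
  induction m with
  | zero =>
    intro q q' r hr _ _ h
    obtain rfl : r = 0 := by simpa using hr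
    simpa using h
  | succ m ih =>
    intro q q' r hr hq hq' h
    have hpow : 0 < k ^ m := pow_pos (by omega) m
    have hdiv : r / k < k ^ m := by
      rw [Nat.div_lt_iff_lt_mul (by omega), ← pow_succ]
      exact hr
    have split : ∀ x, k ^ (m + 1) * x + r = k * (k ^ m * x + r / k) + r % k := by
      intro x
      conv_lhs => rw [← Nat.div_add_mod r k]
      ring
    have big : ∀ x, 6 * k + 10 ≤ x → 6 * k + 10 ≤ k ^ m * x + r / k := fun x hx =>
      (hx.trans (Nat.le_mul_of_pos_left _ hpow)).trans (Nat.le_add_right _ _)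
    rw [split, split]
    exact hg.window_step hk hev (Nat.mod_lt _ (by omega)) (big _ hq) (big _ hq')
      (ih hdiv hq hq' h)

/-! ### Finite kernel and reductions -/

/-- The `k`-kernel of a sequence. -/
def kernelSet (k : ℕ) (s : ℕ → ℤ) : Set (ℕ → ℤ) :=
  {v | ∃ m r, r < k ^ m ∧ v = fun n => s (k ^ m * n + r)}

/-- Choose one representation of each kernel element; if `M` bounds their levels, every class at
level `M + 1` equals one of level at most `M`. -/
theorem hasCompleteReductions_of_finite_kernel {k : ℕ} (hk : 0 < k) {s : ℕ → ℤ}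
    (hfin : (kernelSet k s).Finite) : HasCompleteReductions k s := by
  have hlevel : ∀ v ∈ kernelSet k s, ∃ m r, r < k ^ m ∧ v = fun n => s (k ^ m * n + r) :=
    fun v hv => hv
  choose! level res hres hv using hlevel
  obtain ⟨M, hM⟩ := (hfin.image level).bddAbove
  have hpow : 0 < k ^ (M + 1) := pow_pos hk _
  refine ⟨(Finset.range (k ^ (M + 1))).image fun r => (M + 1, r), ⟨?_, fun N => ?_⟩, ?_⟩
  · simp
  · exact ⟨(M + 1, N % k ^ (M + 1)), by simp [Nat.mod_lt _ hpow], N / k ^ (M + 1),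
      (Nat.div_add_mod _ _).symm⟩
  · intro p hp
    obtain ⟨r, hr, rfl⟩ := Finset.mem_image.1 hp
    have hmem : (fun n => s (k ^ (M + 1) * n + r)) ∈ kernelSet k s :=
      ⟨M + 1, r, Finset.mem_range.1 hr, rfl⟩
    exact ⟨_, _, Nat.lt_succ_of_le (hM ⟨_, hmem, rfl⟩), hres _ hmem, fun n =>
      congrFun (hv _ hmem) n⟩

theorem HasCompleteReductions.isRegularSeq {k : ℕ} {s : ℕ → ℤ}
    (h : HasCompleteReductions k s) : IsRegularSeq k s := by
  obtain ⟨C, hC, h⟩ := h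
  refine ⟨C, hC, fun p hp => ?_⟩
  obtain ⟨e, t, he, ht, hst⟩ := h p hp
  exact ⟨1, fun _ => 1, fun _ => e, fun _ => t, fun _ => ⟨he, ht⟩, by simpa using hst⟩

theorem finite_setOf_factorsThrough {β : Type*} [Finite β] (c : ℕ → β) {A : Set ℤ}
    (hA : A.Finite) (hne : A.Nonempty) :
    {v : ℕ → ℤ | (∀ n, v n ∈ A) ∧ v.FactorsThrough c}.Finite := by
  have := hA.to_subtype
  refine (Set.finite_range fun (f : β → A) n => (f (c n) : ℤ)).subset ?_
  rintro v ⟨hvA, hvc⟩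
  refine ⟨Function.extend c (fun n => ⟨v n, hvA n⟩) fun _ => ⟨_, hne.some_mem⟩, ?_⟩
  funext n
  have hfac : Function.FactorsThrough (fun n => (⟨v n, hvA n⟩ : A)) c :=
    fun a b hab => Subtype.ext (hvc hab)
  simp [hfac.extend_apply]

theorem BlockRec.finite_kernel {k : ℕ} {g : ℕ → ℕ} (hg : BlockRec k g) (hk : 2 ≤ k)
    (hev : Even k) {s : ℕ → ℤ} (hs : ∀ n, 1 ≤ n → s n = g n) : (kernelSet k s).Finite := by
  set Q := 6 * k + 10 with hQ
  have hbound : ∀ n, g n ≤ max 2 (g 0 + g 1) := by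
    intro n
    rcases n with _ | _ | n
    · simp
    · simp
    · exact (hg.spec hk (by omega)).2.trans (le_max_left _ _)
  set B := max 2 (g 0 + g 1)
  -- Finite colouring through which every kernel element factors: small `n` keep their identity,
  -- large ones only their window.
  let c : ℕ → Fin Q ⊕ (Fin (6 * k + 8 + 1) → Fin (B + 1)) := fun n =>
    if h : n < Q then Sum.inl ⟨n, h⟩ else
      Sum.inr fun i => ⟨window g (6 * k + 8) n i, Nat.lt_succ_of_le (hbound _)⟩
  have hA : (insert (s 0) ((fun n : ℕ => (n : ℤ)) '' Set.Iic B)).Finite :=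
    ((Set.finite_Iic B).image _).insert _
  refine (finite_setOf_factorsThrough c hA (Set.insert_nonempty _ _)).subset ?_
  rintro v ⟨m, r, hr, rfl⟩
  refine ⟨fun n => ?_, fun a b hab => ?_⟩
  · dsimp only
    rcases Nat.eq_zero_or_pos (k ^ m * n + r) with h | h
    · rw [h]; exact Set.mem_insert _ _
    · rw [hs _ h]; exact Set.mem_insert_of_mem _ ⟨_, hbound _, rfl⟩
  · by_cases ha : a < Q <;> by_cases hb : b < Q <;> simp only [c, ha, hb, dite_true, dite_false,
      Sum.inl.injEq, Sum.inr.injEq, reduceCtorEq, Fin.mk.injEq] at hab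
    · rw [hab]
    · have hw : window g (6 * k + 8) a = window g (6 * k + 8) b := by
        funext i
        exact congrArg Fin.val (congrFun hab i)
      have hpow : 0 < k ^ m := pow_pos (by omega) m
      have pos : ∀ x, ¬ x < Q → 1 ≤ k ^ m * x + r := fun x hx =>
        Nat.le_add_right_of_le (Nat.mul_pos hpow (by omega))
      -- Windows end one past their base point, so entry 1 is the value there.
      have := window_eq_iff.1 (hg.window_pow hk hev m hr (not_lt.1 ha) (not_lt.1 hb) hw) 1
        (by omega)
      simp only [Nat.add_sub_cancel] at this
      dsimp only
      rw [hs _ (pos a ha), hs _ (pos b hb), this]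

/-- The Sprague–Grundy sequence `SG_{1,2d}(n)`, `n ≥ 1`, is `2d`-regular, whatever value is put at
the index `0`, and the recurrences can be taken to be reductions. -/
theorem mainTheorem2 (d : ℕ) (hd : 1 ≤ d) (s : ℕ → ℤ)
    (hs : ∀ n : ℕ, 1 ≤ n → s n = (SG 1 (2 * d) n : ℤ)) :
    IsRegularSeq (2 * d) s ∧ HasCompleteReductions (2 * d) s := by
  have hk : 2 ≤ 2 * d := by omega
  have h : HasCompleteReductions (2 * d) s :=
    hasCompleteReductions_of_finite_kernel (by omega)
      ((blockRec_SG hk).finite_kernel hk (even_two_mul d) hs)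
  exact ⟨h.isRegularSeq, h⟩
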